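/- Let $k\ge 2$ and $j\ge 0$ be integers. A $k$-colored partition of $n$ is a $k$-tuple $(\pi^{(1)},\dots,\pi^{(k)})$ of (possibly empty) partitions whose sizes add up to $n$; its $k$-crank is $\ell(\pi^{(1)})-\ell(\pi^{(2)})$, where $\ell(\pi)$ is the number of parts of $\pi$. Let $M_k(m,n)$ be the number of $k$-colored partitions of $n$ with $k$-crank $m$, and put $$\mu_{2j,k}(-1,n):=\sum_{m=-n}^{n}\binom{m+j-1}{2j}(-1)^m M_k(m,n),$$ where $\binom{x}{r}=x(x-1)\cdots(x-r+1)/r!$ for every integer $x$. Write $(a;q)_\infty=\prod_{i\ge 0}(1-aq^i)$. Then the following identities hold as identities of formal power series in $q$ with integer coefficients, and the multiple sums on the right converge (coefficientwise): $$\sum_{n=0}^{\infty}\mu_{2j,k}(-1,n)q^n=\frac{1}{(q;q)_\infty^{k-2}(-q;q)_\infty^{2}}\sum_{n_j\ge n_{j-1}\ge\cdots\ge n_1\ge 1}\frac{(-1)^j q^{n_1+n_2+\cdots+n_j}}{(1+q^{n_1})^2(1+q^{n_2})^2\cdots(1+q^{n_j})^2}$$ and $$\sum_{n=0}^{\infty}\mu_{2j,k}(-1,n)q^n=\frac{1}{(q;q)_\infty^{k-2}(-q;q)_\infty^{2}}\sum_{m_j>m_{j-1}>\cdots>m_1\ge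 1}\frac{(-1)^{m_j}\,m_1(m_2-m_1)\cdots(m_j-m_{j-1})\,q^{m_j}}{(1-q^{m_1})(1-q^{m_2})\cdots(1-q^{m_j})}.$$ For $j=0$ each multiple sum has the single term $1$ (the empty tuple, with $m_0=0$). -/

import Mathlib

open scoped PowerSeries PowerSeries.WithPiTopology

namespace KCrank

/-- A `k`-colored partition of `n`: a `k`-tuple of partitions whose sizes `c 0, …, c (k - 1)`
add up to `n` (empty partitions are allowed). -/
abbrev ColoredPartition (k n : ℕ) : Type :=
  Σ c : {c : Fin k → ℕ // c ∈ Finset.Nat.antidiagonalTuple k n}, ∀ i : Fin k, (c.1 i).Partition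

/-- The `k`-crank (`k ≥ 2`) of a `k`-colored partition: the number of parts of its first component
minus the number of parts of its second component. -/
def crank {k : ℕ} (hk : 2 ≤ k) {n : ℕ} (π : ColoredPartition k n) : ℤ :=
  ((π.2 ⟨0, by omega⟩).parts.card : ℤ) - ((π.2 ⟨1, by omega⟩).parts.card : ℤ)

/-- `M_k(m,n)`: the number of `k`-colored partitions of `n` with `k`-crank `m`. -/
def crankCount {k : ℕ} (hk : 2 ≤ k) (m : ℤ) (n : ℕ) : ℕ :=
  Fintype.card {π : ColoredPartition k n // crank hk π = m}

/-- `μ_{2j,k}(-1,n)`: the `2j`-th symmetrized `k`-crank moment weighted by the parity of the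
`k`-crank. `Ring.choose` is the generalized binomial coefficient
`x (x - 1) ⋯ (x - r + 1) / r!`, for every integer `x`. -/
noncomputable def moment (j : ℕ) {k : ℕ} (hk : 2 ≤ k) (n : ℕ) : ℤ :=
  ∑ m ∈ Finset.Icc (-(n : ℤ)) (n : ℤ),
    Ring.choose (m + (j : ℤ) - 1) (2 * j) * (m.negOnePow : ℤ) * (crankCount hk m n : ℤ)

/-- `(a;q)_∞ = ∏_{i ≥ 0} (1 - a q^i)` as a formal power series in `q = X`. The product is taken in
the topology of coefficientwise (eventually constant) convergence. -/
noncomputable def qPochInf (a : ℤ⟦X⟧) : ℤ⟦X⟧ :=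
  ∏' i : ℕ, (1 - a * PowerSeries.X ^ i)

/-- The infinite product that defines `(a;q)_∞` converges. -/
theorem multipliable_qPochInf (a : ℤ⟦X⟧) :
    Multipliable fun i : ℕ => (1 - a * PowerSeries.X ^ i : ℤ⟦X⟧) := by
  simp_rw [sub_eq_add_neg]
  apply PowerSeries.WithPiTopology.multipliable_one_add_of_tendsto_order_atTop_nhds_top
  refine ENat.tendsto_nhds_top_iff_natCast_lt.mpr
    (fun n => Filter.eventually_atTop.mpr ⟨n + 1, fun m hm => ?_⟩)
  rw [PowerSeries.order_neg]
  refine lt_of_lt_of_le ?_ (PowerSeries.le_order_mul _ _)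
  rw [PowerSeries.order_X_pow]
  refine lt_of_lt_of_le ?_ le_add_self
  exact_mod_cast hm

/-- The factor `1 / ((q;q)_∞^{k-2} (-q;q)_∞^2)`, for `k ≥ 2`. `Ring.inverse` is the inverse in the
ring `ℤ⟦X⟧`, here of a series with constant term `1`. -/
noncomputable def prefactor (k : ℕ) : ℤ⟦X⟧ :=
  Ring.inverse (qPochInf PowerSeries.X ^ (k - 2) * qPochInf (-PowerSeries.X) ^ 2)

/-- The tuples `n_j ≥ ⋯ ≥ n_1 ≥ 1`; the entry `n_i` is the value at index `i - 1`. -/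
abbrev WeakTuple (j : ℕ) : Type :=
  {n : Fin j → ℕ // Monotone n ∧ ∀ i, 1 ≤ n i}

/-- The tuples `m_j > ⋯ > m_1 ≥ 1`; the entry `m_i` is the value at index `i - 1`. -/
abbrev StrictTuple (j : ℕ) : Type :=
  {m : Fin j → ℕ // StrictMono m ∧ ∀ i, 1 ≤ m i}

/-- `(-1)^j q^{n_1 + ⋯ + n_j} / ((1 + q^{n_1})^2 ⋯ (1 + q^{n_j})^2)`. -/
noncomputable def weakTerm {j : ℕ} (n : Fin j → ℕ) : ℤ⟦X⟧ :=
  (-1) ^ j * PowerSeries.X ^ (∑ i, n i) *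
    Ring.inverse (∏ i, (1 + PowerSeries.X ^ n i) ^ 2)

/-- The tuple `(m_0, m_1, …, m_j)` with `m_0 = 0` prepended. -/
def consZero {j : ℕ} (m : Fin j → ℕ) : Fin (j + 1) → ℕ :=
  Fin.cons 0 m

/-- `(-1)^{m_j} m_1 (m_2 - m_1) ⋯ (m_j - m_{j-1}) q^{m_j} / ((1 - q^{m_1}) ⋯ (1 - q^{m_j}))`,
where `m_0 = 0`, so that the first factor is `m_1 - m_0`, and so that the term is `1` for
`j = 0`. -/
noncomputable def strictTerm {j : ℕ} (m : Fin j → ℕ) : ℤ⟦X⟧ :=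
  (-1) ^ consZero m (Fin.last j) *
    (∏ i : Fin j, ((consZero m i.succ : ℤ⟦X⟧) - (consZero m i.castSucc : ℤ⟦X⟧))) *
    PowerSeries.X ^ consZero m (Fin.last j) *
    Ring.inverse (∏ i, (1 - PowerSeries.X ^ m i))

end KCrank

/-!
Put `E = z + 2 + z⁻¹`, so that `(1 - z q^n) (1 - z⁻¹ q^n) = (1 + q^n)^2 - q^n E`. The functional
`L_j : z^m ↦ (-1)^m binom(m + j - 1, 2j)` on Laurent polynomials satisfies `L_0(E f) = 0` and
`L_{j+1}(E f) = -L_j(f)`: up to the sign `(-1)^j` it extracts the coefficient of `E^j`. Applied to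
`∏ 1 / ((1 - z q^n) (1 - z⁻¹ q^n))` it therefore gives `∏ (1 + q^n)^(-2)` times the complete
homogeneous symmetric function of degree `j` in the `-q^n / (1 + q^n)^2`, which is the sum over
weakly increasing tuples.

Expand each `-q^n / (1 + q^n)^2` as `∑ b (-q^n)^b`, where `b ≥ 1`. The exponent of `q` in the
resulting terms is `∑ b_i n_i`, and summation by parts rewrites it in terms of the differences of
the `n_i` and the partial sums `m_i` of the `b_i`. Summing the geometric series over the differences
of the `n_i` first leaves the sum over strictly increasing tuples.
-/

namespace KCrank

open Filter PowerSeries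
open scoped LaurentPolynomial Topology

/-! ### Inverses -/

section Inverse

variable {M : Type*} [CommMonoidWithZero M]

theorem inverse_eq_of_mul_eq_one {a b : M} (h : a * b = 1) : Ring.inverse a = b :=
  Ring.inverse_unit (Units.mkOfMulEqOne a b h)

theorem inverse_prod {ι : Type*} (s : Finset ι) (f : ι → M) :
    Ring.inverse (∏ i ∈ s, f i) = ∏ i ∈ s, Ring.inverse (f i) :=
  map_prod (MonoidHom.mk ⟨Ring.inverse, Ring.inverse_one M⟩ fun a b =>
    (Ring.mul_inverse_rev a b).trans (mul_comm _ _)) f s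

end Inverse

/-! ### Summable families of power series -/

section Summation

theorem finite_setOf_sum_le (ι : Type*) [Fintype ι] (d : ℕ) :
    {a : ι → ℕ | ∑ i, a i ≤ d}.Finite := by
  classical
  exact (Set.finite_Iic fun _ : ι => d).subset fun _ ha i =>
    (Finset.single_le_sum (fun _ _ => Nat.zero_le _) (Finset.mem_univ i)).trans ha

theorem finite_setOf_add_le {α β : Type*} {u : α → ℕ} {v : β → ℕ}
    (hu : ∀ d, {a | u a ≤ d}.Finite) (hv : ∀ d, {b | v b ≤ d}.Finite) (d : ℕ) :
    {p : α × β | u p.1 + v p.2 ≤ d}.Finite :=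
  ((hu d).prod (hv d)).subset fun _ hp =>
    ⟨(Nat.le_add_right _ _).trans hp, (Nat.le_add_left _ _).trans hp⟩

theorem summable_of_X_pow_dvd {R ι : Type*} [Semiring R] [TopologicalSpace R] {f : ι → R⟦X⟧}
    (w : ι → ℕ) (hw : ∀ d, {i | w i ≤ d}.Finite) (h : ∀ i, X ^ w i ∣ f i) : Summable f := by
  rw [WithPiTopology.summable_iff_summable_coeff]
  refine fun d => summable_of_hasFiniteSupport ((hw d).subset fun i hi => ?_)
  by_contra hlt
  exact hi (X_pow_dvd_iff.mp (h i) d (not_le.mp hlt))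

variable {R : Type*} [CommRing R] [TopologicalSpace R] [IsTopologicalRing R] [T2Space R]

theorem hasSum_prod_pi : ∀ {j : ℕ} {f : Fin j → ℕ → R⟦X⟧} {s : Fin j → R⟦X⟧},
    (∀ i a, X ^ a ∣ f i a) → (∀ i, HasSum (f i) (s i)) →
      HasSum (fun a : Fin j → ℕ => ∏ i, f i (a i)) (∏ i, s i)
  | 0, _, _, _, _ => by simp
  | j + 1, f, s, hdvd, hs => by
    have htail := hasSum_prod_pi (fun i : Fin j => hdvd i.succ) fun i => hs i.succ
    have hsum : Summable fun p : ℕ × (Fin j → ℕ) => f 0 p.1 * ∏ i : Fin j, f i.succ (p.2 i) := by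
      refine summable_of_X_pow_dvd (fun p => p.1 + ∑ i, p.2 i)
        (finite_setOf_add_le Set.finite_Iic (finite_setOf_sum_le (Fin j))) fun p => ?_
      rw [pow_add, ← Finset.prod_pow_eq_pow_sum]
      exact mul_dvd_mul (hdvd 0 p.1)
        (Finset.prod_dvd_prod_of_dvd _ _ fun i _ => hdvd i.succ (p.2 i))
    rw [← (Fin.consEquiv fun _ : Fin (j + 1) => ℕ).hasSum_iff, Fin.prod_univ_succ]
    refine ((hs 0).mul htail hsum).congr_fun fun p => ?_
    simp only [Function.comp_apply, Fin.consEquiv_apply, Fin.prod_univ_succ, Fin.cons_zero,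
      Fin.cons_succ]

variable {y : R⟦X⟧}

theorem hasSum_pow (hy : constantCoeff y = 0) :
    HasSum (fun a : ℕ => y ^ a) (Ring.inverse (1 - y)) := by
  rw [inverse_eq_of_mul_eq_one (WithPiTopology.one_sub_mul_tsum_pow_of_constantCoeff_eq_zero hy)]
  exact (WithPiTopology.summable_pow_of_constantCoeff_eq_zero hy).hasSum

theorem hasSum_succ_mul_pow_succ (hy : constantCoeff y = 0) :
    HasSum (fun a : ℕ => ((a + 1 : ℕ) : R⟦X⟧) * y ^ (a + 1))
      (y * Ring.inverse ((1 - y) ^ 2)) := by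
  have hsum : Summable fun a : ℕ => (a : R⟦X⟧) * y ^ a :=
    summable_of_X_pow_dvd id Set.finite_Iic fun a =>
      (pow_dvd_pow_of_dvd (X_dvd_iff.mpr hy) a).mul_left _
  obtain ⟨T, hT⟩ := hsum
  have hshift : HasSum (fun a : ℕ => ((a + 1 : ℕ) : R⟦X⟧) * y ^ (a + 1)) T := by
    simpa using (hasSum_nat_add_iff' 1).mpr hT
  have hdiff : HasSum (fun a : ℕ => y * y ^ a) (T - y * T) :=
    (hshift.sub (hT.mul_left y)).congr_fun fun a => by push_cast; ring
  have hgeom : T * (1 - y) = y * Ring.inverse (1 - y) := by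
    rw [← hdiff.unique ((hasSum_pow hy).mul_left y)]
    ring
  have hunit : IsUnit (1 - y) := isUnit_iff_constantCoeff.mpr (by simp [hy])
  have hT_eq : T = y * Ring.inverse ((1 - y) ^ 2) := by
    rw [Ring.eq_mul_inverse_iff_mul_eq _ _ _ (hunit.pow 2), sq, ← mul_assoc, hgeom,
      Ring.inverse_mul_cancel_right _ _ hunit]
  exact hT_eq ▸ hshift

end Summation

/-! ### Tuples and their successive differences -/

section Tuples

variable {j : ℕ}

theorem strictMono_cons {α : Type*} [Preorder α] {a : α} {n : Fin j → α} :
    StrictMono (Fin.cons a n : Fin (j + 1) → α) ↔ (∀ i, a < n i) ∧ StrictMono n := by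
  simp [StrictMono, Fin.forall_fin_succ]

theorem monotone_cons {α : Type*} [Preorder α] {a : α} {n : Fin j → α} :
    Monotone (Fin.cons a n : Fin (j + 1) → α) ↔ (∀ i, a ≤ n i) ∧ Monotone n := by
  simp [Monotone, Fin.forall_fin_succ]

theorem monotone_snoc {α : Type*} [Preorder α] {a : α} {n : Fin j → α} :
    Monotone (Fin.snoc n a : Fin (j + 1) → α) ↔ Monotone n ∧ ∀ i, n i ≤ a := by
  simp [Monotone, Fin.forall_fin_succ', forall_and, Fin.le_last, (Fin.castSucc_lt_last _).not_ge]

theorem add_partialSum_tsub {M : Type*} [AddCommMonoid M] [PartialOrder M] [ExistsAddOfLE M]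
    [AddLeftMono M] [Sub M] [OrderedSub M] {g : Fin (j + 1) → M} (hg : Monotone g)
    (i : Fin (j + 1)) :
    g 0 + Fin.partialSum (fun l : Fin j => g l.succ - g l.castSucc) i = g i := by
  induction i using Fin.induction with
  | zero => simp
  | succ i ih =>
    rw [Fin.partialSum_succ, ← add_assoc, ih, add_tsub_cancel_of_le (hg i.castSucc_le_succ)]

theorem partialSum_eq_sum {M : Type*} [AddCommMonoid M] (d : Fin j → M) (i : Fin (j + 1)) :
    Fin.partialSum d i = ∑ l with l.castSucc < i, d l :=
  List.sum_take_ofFn d i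

theorem partialSum_last {M : Type*} [AddCommMonoid M] (d : Fin j → M) :
    Fin.partialSum d (Fin.last j) = ∑ i, d i := by
  simp [partialSum_eq_sum, Fin.castSucc_lt_last]

theorem sum_mul_partialSum_rev {R : Type*} [CommSemiring R] (a d : Fin j → R) :
    ∑ i, a i * Fin.partialSum d i.rev.succ = ∑ l, d l * Fin.partialSum a l.rev.succ := by
  simp only [partialSum_eq_sum, Fin.castSucc_lt_succ_iff, Finset.mul_sum]
  rw [Finset.sum_comm' (t' := Finset.univ) (s' := fun l => {i | i ≤ l.rev})
    fun i l => by simp [Fin.le_rev_iff (i := l)]]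
  simp only [mul_comm (d _)]

theorem monotone_partialSum (d : Fin j → ℕ) : Monotone (Fin.partialSum d) :=
  Fin.monotone_iff_le_succ.mpr fun i => by simp [Fin.partialSum_succ]

theorem strictMono_partialSum {d : Fin j → ℕ} (hd : ∀ i, 0 < d i) :
    StrictMono (Fin.partialSum d) :=
  Fin.strictMono_iff_lt_succ.mpr fun i => by simp [Fin.partialSum_succ, hd]

theorem cons_add_partialSum {M : Type*} [AddCommMonoid M] (c : M) (d : Fin j → M) :
    (Fin.cons c fun i => c + Fin.partialSum d i.succ : Fin (j + 1) → M) =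
      fun i => c + Fin.partialSum d i := by
  rw [← Fin.cons_self_tail fun i => c + Fin.partialSum d i, Fin.partialSum_zero, add_zero]
  rfl

/-- The weakly increasing tuples are parametrized by their successive differences `d`, the first
difference being taken from `1`. -/
def weakTupleEquiv (j : ℕ) : (Fin j → ℕ) ≃ WeakTuple j where
  toFun d := ⟨fun i => 1 + Fin.partialSum d i.succ,
    ((monotone_partialSum d).const_add 1).comp Fin.strictMono_succ.monotone,
    fun _ => Nat.le_add_right _ _⟩
  invFun n i := (Fin.cons 1 n.1 : Fin (j + 1) → ℕ) i.succ -
    (Fin.cons 1 n.1 : Fin (j + 1) → ℕ) i.castSucc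
  left_inv d := funext fun i => by
    simp only [cons_add_partialSum 1 d]
    rw [Fin.partialSum_succ, ← add_assoc, Nat.add_sub_cancel_left]
  right_inv n := Subtype.ext <| funext fun i =>
    add_partialSum_tsub (monotone_cons.mpr n.2.symm) i.succ

theorem coe_weakTupleEquiv (d : Fin j → ℕ) (i : Fin j) :
    (weakTupleEquiv j d).1 i = 1 + Fin.partialSum d i.succ := rfl

theorem consZero_partialSum (d : Fin j → ℕ) :
    consZero (fun i => Fin.partialSum d i.succ) = Fin.partialSum d := by
  simpa [consZero] using cons_add_partialSum 0 d

/-- The strictly increasing tuples of positive integers are parametrized by the `b` for which their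
successive differences, the first one being taken from `0`, are `b i + 1`. -/
def strictTupleEquiv (j : ℕ) : (Fin j → ℕ) ≃ StrictTuple j where
  toFun b := ⟨fun i => Fin.partialSum (fun l => b l + 1) i.succ,
    (strictMono_partialSum fun _ => Nat.succ_pos _).comp Fin.strictMono_succ,
    fun i => by simp [Fin.partialSum_succ, ← add_assoc]⟩
  invFun m i := consZero m.1 i.succ - consZero m.1 i.castSucc - 1
  left_inv b := funext fun i => by
    dsimp only
    rw [consZero_partialSum, Fin.partialSum_succ, Nat.add_sub_cancel_left, Nat.add_sub_cancel]
  right_inv m := by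
    have hm : StrictMono (consZero m.1) := strictMono_cons.mpr m.2.symm
    have hdiff (i : Fin j) : consZero m.1 i.succ - consZero m.1 i.castSucc - 1 + 1 =
        consZero m.1 i.succ - consZero m.1 i.castSucc :=
      Nat.sub_add_cancel (Nat.sub_pos_of_lt (hm i.castSucc_lt_succ))
    refine Subtype.ext <| funext fun i => ?_
    simp only [hdiff]
    simpa [consZero] using add_partialSum_tsub hm.monotone i.succ

theorem coe_strictTupleEquiv (b : Fin j → ℕ) (i : Fin j) :
    (strictTupleEquiv j b).1 i = Fin.partialSum (fun l => b l + 1) i.succ := rfl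

theorem consZero_strictTupleEquiv (b : Fin j → ℕ) :
    consZero (strictTupleEquiv j b).1 = Fin.partialSum fun i => b i + 1 :=
  consZero_partialSum _

theorem sum_mul_weakTupleEquiv_rev (b d : Fin j → ℕ) :
    ∑ i, (b i + 1) * (weakTupleEquiv j d).1 i.rev =
      ∑ i, (b i + 1) + ∑ l, d l * (strictTupleEquiv j b).1 l.rev := by
  simp only [coe_weakTupleEquiv, coe_strictTupleEquiv, mul_add, mul_one, Finset.sum_add_distrib]
  rw [← sum_mul_partialSum_rev fun i => b i + 1]

end Tuples

/-! ### The double series -/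

/-- The factor `-q^n / (1 + q^n)^2` that an entry `n` contributes to `weakTerm`. -/
noncomputable def weakFactor (n : ℕ) : ℤ⟦X⟧ :=
  -X ^ n * Ring.inverse ((1 + X ^ n) ^ 2)

theorem weakTerm_eq_prod {j : ℕ} (n : Fin j → ℕ) : weakTerm n = ∏ i, weakFactor (n i) := by
  simp only [weakTerm, weakFactor, inverse_prod, Finset.prod_mul_distrib, Finset.prod_neg,
    Finset.card_univ, Fintype.card_fin, Finset.prod_pow_eq_pow_sum]

theorem constantCoeff_X_pow_of_pos {R : Type*} [Semiring R] {n : ℕ} (hn : 0 < n) :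
    constantCoeff (X ^ n : R⟦X⟧) = 0 := by
  simp [hn.ne']

section DoubleSeries

variable {j : ℕ}

/-- The common refinement of `weakTerm` and `strictTerm`: summing it over `b` expands the factors
`-q^n / (1 + q^n)^2 = ∑ b, (b + 1) (-q^n)^(b + 1)`, and summing it over `d` expands the factors
`1 / (1 - q^m)`. Reversing the indices of the weakly increasing tuple makes the two roles
symmetric. -/
noncomputable def doubleTerm (b d : Fin j → ℕ) : ℤ⟦X⟧ :=
  ∏ i, ((b i + 1 : ℕ) : ℤ⟦X⟧) * (-X ^ (weakTupleEquiv j d).1 i.rev) ^ (b i + 1)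

theorem doubleTerm_eq (b d : Fin j → ℕ) :
    doubleTerm b d =
      (-1) ^ (∑ i, (b i + 1)) * (∏ i, ((b i + 1 : ℕ) : ℤ⟦X⟧)) * X ^ (∑ i, (b i + 1)) *
        ∏ l, (X ^ (strictTupleEquiv j b).1 l.rev) ^ d l := by
  have hsplit (i : Fin j) : (-X ^ (weakTupleEquiv j d).1 i.rev : ℤ⟦X⟧) ^ (b i + 1) =
      (-1) ^ (b i + 1) * X ^ ((b i + 1) * (weakTupleEquiv j d).1 i.rev) := by
    rw [neg_pow, ← pow_mul, mul_comm (b i + 1)]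
  have hexp : (X : ℤ⟦X⟧) ^ (∑ i, (b i + 1) * (weakTupleEquiv j d).1 i.rev) =
      X ^ (∑ i, (b i + 1)) * ∏ l, (X ^ (strictTupleEquiv j b).1 l.rev) ^ d l := by
    simp only [sum_mul_weakTupleEquiv_rev, pow_add, ← pow_mul, Finset.prod_pow_eq_pow_sum,
      mul_comm (d _)]
  simp only [doubleTerm, hsplit, Finset.prod_mul_distrib, Finset.prod_pow_eq_pow_sum, hexp]
  ring

theorem hasSum_doubleTerm_left (d : Fin j → ℕ) :
    HasSum (fun b => doubleTerm b d) (weakTerm (weakTupleEquiv j d).1) := by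
  have hcoeff (i : Fin j) : constantCoeff (-X ^ (weakTupleEquiv j d).1 i.rev : ℤ⟦X⟧) = 0 := by
    rw [map_neg, constantCoeff_X_pow_of_pos ((weakTupleEquiv j d).2.2 _), neg_zero]
  rw [weakTerm_eq_prod, ← Equiv.prod_comp Fin.revPerm]
  refine hasSum_prod_pi (f := fun i a => ((a + 1 : ℕ) : ℤ⟦X⟧) *
    (-X ^ (weakTupleEquiv j d).1 i.rev) ^ (a + 1)) (fun i a => Dvd.dvd.mul_left ?_ _) fun i => ?_
  · exact (pow_dvd_pow _ a.le_succ).trans (pow_dvd_pow_of_dvd (X_dvd_iff.mpr (hcoeff i)) _)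
  · simpa only [weakFactor, Fin.revPerm_apply, sub_neg_eq_add] using
      hasSum_succ_mul_pow_succ (hcoeff i)

theorem strictTerm_strictTupleEquiv (b : Fin j → ℕ) :
    strictTerm (strictTupleEquiv j b).1 =
      (-1) ^ (∑ i, (b i + 1)) * (∏ i, ((b i + 1 : ℕ) : ℤ⟦X⟧)) * X ^ (∑ i, (b i + 1)) *
        ∏ l : Fin j, Ring.inverse (1 - X ^ (strictTupleEquiv j b).1 l.rev) := by
  have hdiff (i : Fin j) : (consZero (strictTupleEquiv j b).1 i.succ : ℤ⟦X⟧) -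
      (consZero (strictTupleEquiv j b).1 i.castSucc : ℤ⟦X⟧) = ((b i + 1 : ℕ) : ℤ⟦X⟧) := by
    rw [consZero_strictTupleEquiv, Fin.partialSum_succ, Nat.cast_add, add_sub_cancel_left]
  have hrev : ∏ i, Ring.inverse (1 - X ^ (strictTupleEquiv j b).1 i : ℤ⟦X⟧) =
      ∏ l : Fin j, Ring.inverse (1 - X ^ (strictTupleEquiv j b).1 l.rev) :=
    (Equiv.prod_comp Fin.revPerm _).symm
  rw [strictTerm, Finset.prod_congr rfl fun i _ => hdiff i, inverse_prod, hrev,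
    consZero_strictTupleEquiv, partialSum_last]

theorem hasSum_doubleTerm_right (b : Fin j → ℕ) :
    HasSum (fun d => doubleTerm b d) (strictTerm (strictTupleEquiv j b).1) := by
  have hcoeff (l : Fin j) : constantCoeff (X ^ (strictTupleEquiv j b).1 l.rev : ℤ⟦X⟧) = 0 :=
    constantCoeff_X_pow_of_pos ((strictTupleEquiv j b).2.2 _)
  simp only [strictTerm_strictTupleEquiv, doubleTerm_eq]
  exact (hasSum_prod_pi (fun l a => pow_dvd_pow_of_dvd (X_dvd_iff.mpr (hcoeff l)) a)
    fun l => hasSum_pow (hcoeff l)).mul_left _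

theorem summable_doubleTerm (j : ℕ) :
    Summable fun p : (Fin j → ℕ) × (Fin j → ℕ) => doubleTerm p.1 p.2 := by
  refine summable_of_X_pow_dvd (fun p => ∑ i, p.1 i + ∑ i, p.2 i)
    (finite_setOf_add_le (finite_setOf_sum_le _) (finite_setOf_sum_le _)) fun p => ?_
  rw [doubleTerm_eq, pow_add]
  refine mul_dvd_mul (Dvd.dvd.mul_left (pow_dvd_pow _ ?_) _) ?_
  · exact Finset.sum_le_sum fun i _ => Nat.le_succ _
  · rw [← Finset.prod_pow_eq_pow_sum]
    exact Finset.prod_dvd_prod_of_dvd _ _ fun l _ => pow_dvd_pow_of_dvd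
      (dvd_pow_self X (Nat.pos_iff_ne_zero.mp ((strictTupleEquiv j p.1).2.2 _))) _

theorem exists_hasSum_weakTerm_and_hasSum_strictTerm (j : ℕ) :
    ∃ S : ℤ⟦X⟧, HasSum (fun n : WeakTuple j => weakTerm n.1) S ∧
      HasSum (fun m : StrictTuple j => strictTerm m.1) S := by
  obtain ⟨S, hS⟩ := summable_doubleTerm j
  refine ⟨S, (weakTupleEquiv j).hasSum_iff.mp ?_, (strictTupleEquiv j).hasSum_iff.mp ?_⟩
  · exact ((Equiv.prodComm _ _).hasSum_iff.mpr hS).prod_fiberwise hasSum_doubleTerm_left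
  · exact hS.prod_fiberwise hasSum_doubleTerm_right

end DoubleSeries

/-! ### Truncations of the sum over weakly increasing tuples -/

section CompleteHomogeneous

open Classical in
/-- The weakly increasing `j`-tuples with entries between `1` and `N`. -/
noncomputable def boundedTuples (j N : ℕ) : Finset (Fin j → ℕ) :=
  {n ∈ Fintype.piFinset fun _ => Finset.Icc 1 N | Monotone n}

theorem mem_boundedTuples {j N : ℕ} {n : Fin j → ℕ} :
    n ∈ boundedTuples j N ↔ (∀ i, 1 ≤ n i ∧ n i ≤ N) ∧ Monotone n := by
  simp [boundedTuples]

theorem boundedTuples_zero_left (N : ℕ) : boundedTuples 0 N = Finset.univ :=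
  Finset.eq_univ_iff_forall.mpr fun n =>
    mem_boundedTuples.mpr ⟨fun i => i.elim0, Subsingleton.monotone n⟩

theorem boundedTuples_succ_zero (j : ℕ) : boundedTuples (j + 1) 0 = ∅ := by
  refine Finset.eq_empty_of_forall_notMem fun n hn => ?_
  obtain ⟨hpos, hle⟩ := (mem_boundedTuples.mp hn).1 0
  omega

theorem snoc_mem_boundedTuples {j N a : ℕ} {n : Fin j → ℕ} :
    (Fin.snoc n a : Fin (j + 1) → ℕ) ∈ boundedTuples (j + 1) N ↔
      n ∈ boundedTuples j a ∧ 1 ≤ a ∧ a ≤ N := by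
  simp only [mem_boundedTuples, Fin.forall_fin_succ', Fin.snoc_castSucc, Fin.snoc_last,
    monotone_snoc]
  constructor
  · rintro ⟨⟨hn, ha⟩, hmono, hle⟩
    exact ⟨⟨fun i => ⟨(hn i).1, hle i⟩, hmono⟩, ha⟩
  · rintro ⟨⟨hn, hmono⟩, ha⟩
    exact ⟨⟨fun i => ⟨(hn i).1, (hn i).2.trans ha.2⟩, ha⟩, hmono, fun i => (hn i).2⟩

theorem boundedTuples_succ_succ (j N : ℕ) :
    boundedTuples (j + 1) (N + 1) = boundedTuples (j + 1) N ∪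
      (boundedTuples j (N + 1)).image fun n => Fin.snoc n (N + 1) := by
  ext n
  induction n using Fin.snocCases with
  | _ n a =>
  simp only [Finset.mem_union, Finset.mem_image, snoc_mem_boundedTuples, Fin.snoc_inj]
  constructor
  · rintro ⟨hn, ha, haN⟩
    obtain haN | rfl := Nat.le_succ_iff.mp haN
    · exact .inl ⟨hn, ha, haN⟩
    · exact .inr ⟨n, hn, rfl, rfl⟩
  · rintro (⟨hn, ha, haN⟩ | ⟨_, hn, rfl, rfl⟩)
    · exact ⟨hn, ha, haN.trans N.le_succ⟩
    · exact ⟨hn, N.succ_pos, le_rfl⟩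

variable {R : Type*} [CommSemiring R]

/-- The complete homogeneous symmetric polynomial of degree `j` in `x 1, …, x N`. -/
noncomputable def completeHomogeneous (x : ℕ → R) (j N : ℕ) : R :=
  ∑ n ∈ boundedTuples j N, ∏ i, x (n i)

variable (x : ℕ → R)

theorem completeHomogeneous_zero_left (N : ℕ) : completeHomogeneous x 0 N = 1 := by
  simp [completeHomogeneous, boundedTuples_zero_left]

theorem completeHomogeneous_succ_zero (j : ℕ) : completeHomogeneous x (j + 1) 0 = 0 := by
  simp [completeHomogeneous, boundedTuples_succ_zero]

theorem completeHomogeneous_succ_succ (j N : ℕ) :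
    completeHomogeneous x (j + 1) (N + 1) =
      completeHomogeneous x (j + 1) N + x (N + 1) * completeHomogeneous x j (N + 1) := by
  have hdisj : Disjoint (boundedTuples (j + 1) N)
      ((boundedTuples j (N + 1)).image fun n => Fin.snoc n (N + 1)) := by
    simp only [Finset.disjoint_right, Finset.forall_mem_image, snoc_mem_boundedTuples]
    omega
  rw [completeHomogeneous, boundedTuples_succ_succ, Finset.sum_union hdisj,
    Finset.sum_image (Fin.snoc_left_injective _).injOn, completeHomogeneous, completeHomogeneous,
    Finset.mul_sum]
  simp only [Fin.prod_univ_castSucc, Fin.snoc_castSucc, Fin.snoc_last, mul_comm]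

theorem tendsto_completeHomogeneous [TopologicalSpace R] {x : ℕ → R} {j : ℕ} {S : R}
    (hS : HasSum (fun n : WeakTuple j => ∏ i, x (n.1 i)) S) :
    Tendsto (completeHomogeneous x j) atTop (𝓝 S) := by
  classical
  let truncation (N : ℕ) : Finset (WeakTuple j) := (boundedTuples j N).subtype _
  have htruncation : Tendsto truncation atTop atTop := by
    refine tendsto_atTop_finset_of_monotone (fun M N hMN n hn => ?_) fun n => ⟨∑ i, n.1 i, ?_⟩
    · simp only [truncation, Finset.mem_subtype, mem_boundedTuples] at hn ⊢
      exact ⟨fun i => ⟨(hn.1 i).1, (hn.1 i).2.trans hMN⟩, hn.2⟩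
    · simp only [truncation, Finset.mem_subtype, mem_boundedTuples]
      exact ⟨fun i => ⟨n.2.2 i, Finset.single_le_sum (fun _ _ => Nat.zero_le _)
        (Finset.mem_univ i)⟩, n.2.1⟩
  refine (hS.comp htruncation).congr fun N => ?_
  exact Finset.sum_subtype_of_mem (fun n : Fin j → ℕ => ∏ i, x (n i)) fun n hn =>
    ⟨(mem_boundedTuples.mp hn).2, fun i => ((mem_boundedTuples.mp hn).1 i).1⟩

end CompleteHomogeneous

/-! ### The crank functional on Laurent polynomials -/

section CrankFunctional

open LaurentPolynomial (T T_add T_sub)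

/-- The weight `(-1)^m binom(m + j - 1, 2j)` of the crank `m` in the `2j`-th moment. -/
noncomputable def crankWeight (j : ℕ) (m : ℤ) : ℤ :=
  Ring.choose (m + (j : ℤ) - 1) (2 * j) * (m.negOnePow : ℤ)

theorem crankWeight_zero_left (m : ℤ) : crankWeight 0 m = m.negOnePow := by
  simp [crankWeight]

theorem crankWeight_succ_zero (j : ℕ) : crankWeight (j + 1) 0 = 0 := by
  have hj : (0 : ℤ) + ((j + 1 : ℕ) : ℤ) - 1 = (j : ℕ) := by push_cast; ring
  rw [crankWeight, hj, Ring.choose_natCast, Nat.choose_eq_zero_of_lt (by omega), Nat.cast_zero,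
    zero_mul]

theorem crankWeight_succ_add_add (j : ℕ) (m : ℤ) :
    crankWeight (j + 1) (m + 1) + 2 * crankWeight (j + 1) m + crankWeight (j + 1) (m - 1) =
      -crankWeight j m := by
  have hadd : (m + 1) + ((j + 1 : ℕ) : ℤ) - 1 = (m + j - 1) + 1 + 1 := by push_cast; ring
  have hmid : m + ((j + 1 : ℕ) : ℤ) - 1 = (m + j - 1) + 1 := by push_cast; ring
  have hsub : (m - 1) + ((j + 1 : ℕ) : ℤ) - 1 = m + j - 1 := by push_cast; ring
  simp only [crankWeight, hadd, hmid, hsub, Nat.mul_succ, Ring.choose_succ_succ,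
    Int.negOnePow_sub, Int.negOnePow_succ, Int.negOnePow_one, mul_neg, mul_one, Units.val_neg]
  ring

theorem crankWeight_zero_add_add (m : ℤ) :
    crankWeight 0 (m + 1) + 2 * crankWeight 0 m + crankWeight 0 (m - 1) = 0 := by
  simp only [crankWeight_zero_left, Int.negOnePow_sub, Int.negOnePow_succ, Int.negOnePow_one,
    mul_neg, mul_one, Units.val_neg]
  ring

/-- The functional on Laurent polynomials in `z` that sends `z^m` to `crankWeight j m`. -/
noncomputable def crankFunctional (j : ℕ) : ℤ[T;T⁻¹] →ₗ[ℤ] ℤ :=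
  Finsupp.linearCombination ℤ (crankWeight j) ∘ₗ
    (AddMonoidAlgebra.coeffLinearEquiv ℤ).toLinearMap

theorem crankFunctional_T (j : ℕ) (m : ℤ) : crankFunctional j (T m) = crankWeight j m :=
  (Finsupp.linearCombination_single ℤ 1 m).trans (one_smul ℤ _)

theorem linearMap_ext_T {R M : Type*} [CommSemiring R] [AddCommMonoid M] [Module R M]
    {φ ψ : R[T;T⁻¹] →ₗ[R] M} (h : ∀ m, φ (T m) = ψ (T m)) : φ = ψ :=
  AddMonoidAlgebra.lhom_ext' fun m => LinearMap.ext_ring (h m)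

/-- The Laurent polynomial `z + 2 + z⁻¹`. -/
noncomputable def crankStep : ℤ[T;T⁻¹] := T 1 + 2 + T (-1)

theorem crankFunctional_crankStep_mul_T (j : ℕ) (m : ℤ) :
    crankFunctional j (crankStep * T m) =
      crankWeight j (m + 1) + 2 * crankWeight j m + crankWeight j (m - 1) := by
  have hstep : crankStep * T m = T (m + 1) + (2 : ℤ) • T m + T (m - 1) := by
    rw [crankStep, T_add, T_sub, two_smul]
    ring
  simp only [hstep, map_add, map_smul, crankFunctional_T, smul_eq_mul]

theorem crankFunctional_succ_crankStep_mul (j : ℕ) (f : ℤ[T;T⁻¹]) :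
    crankFunctional (j + 1) (crankStep * f) = -crankFunctional j f := by
  have hmaps : crankFunctional (j + 1) ∘ₗ LinearMap.mulLeft ℤ crankStep = -crankFunctional j :=
    linearMap_ext_T fun m => by
      simp [crankFunctional_crankStep_mul_T, crankFunctional_T, crankWeight_succ_add_add]
  exact LinearMap.congr_fun hmaps f

theorem crankFunctional_zero_crankStep_mul (f : ℤ[T;T⁻¹]) :
    crankFunctional 0 (crankStep * f) = 0 := by
  have hmaps : crankFunctional 0 ∘ₗ LinearMap.mulLeft ℤ crankStep = 0 :=
    linearMap_ext_T fun m => by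
      simp [crankFunctional_crankStep_mul_T, crankWeight_zero_add_add]
  exact LinearMap.congr_fun hmaps f

end CrankFunctional

/-! ### The crank functional on power series -/

section MapCoeff

variable {R A : Type*} [CommSemiring R] [CommSemiring A] [Algebra R A]

/-- Applying an `R`-linear functional to every coefficient of a power series over an `R`-algebra,
as a map that is linear over `R⟦X⟧`. -/
noncomputable def mapCoeff (φ : A →ₗ[R] R) : A⟦X⟧ →ₗ[R⟦X⟧] R⟦X⟧ where
  toFun f := .mk fun n => φ (coeff n f)
  map_add' f g := by ext; simp
  map_smul' c f := by
    ext n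
    simp only [Algebra.smul_def c f, algebraMap_apply'', coeff_mul, coeff_mk, coeff_map, map_sum,
      ← Algebra.smul_def, map_smul, smul_eq_mul, RingHom.id_apply]

theorem coeff_mapCoeff (φ : A →ₗ[R] R) (n : ℕ) (f : A⟦X⟧) :
    coeff n (mapCoeff φ f) = φ (coeff n f) :=
  coeff_mk n fun n => φ (coeff n f)

theorem mapCoeff_C (φ : A →ₗ[R] R) (a : A) : mapCoeff φ (C a) = C (φ a) := by
  ext n
  simp only [coeff_mapCoeff, coeff_C, apply_ite φ, map_zero]

theorem mapCoeff_map_mul (φ : A →ₗ[R] R) (c : R⟦X⟧) (f : A⟦X⟧) :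
    mapCoeff φ (map (algebraMap R A) c * f) = c * mapCoeff φ f := by
  rw [← algebraMap_apply'', ← Algebra.smul_def, map_smul, smul_eq_mul]

theorem continuous_mapCoeff [TopologicalSpace R] [TopologicalSpace A] {φ : A →ₗ[R] R}
    (hφ : Continuous φ) : Continuous (mapCoeff φ) :=
  continuous_pi fun _ => hφ.comp (WithPiTopology.continuous_coeff A _)

end MapCoeff

section CrankMap

open LaurentPolynomial (T T_zero T_add)

/-- The map `ℤ[z, z⁻¹]⟦q⟧ → ℤ⟦q⟧` that sends `z^m` to `crankWeight j m`. -/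
noncomputable def crankMap (j : ℕ) : ℤ[T;T⁻¹]⟦X⟧ →ₗ[ℤ⟦X⟧] ℤ⟦X⟧ :=
  mapCoeff (crankFunctional j)

theorem crankMap_one (j : ℕ) : crankMap j 1 = C (crankWeight j 0) := by
  rw [← crankFunctional_T, T_zero, ← mapCoeff_C, map_one C, crankMap]

theorem crankMap_succ_C_crankStep_mul (j : ℕ) (f : ℤ[T;T⁻¹]⟦X⟧) :
    crankMap (j + 1) (C crankStep * f) = -crankMap j f := by
  ext n
  simp only [crankMap, coeff_mapCoeff, coeff_C_mul, crankFunctional_succ_crankStep_mul, map_neg]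

theorem crankMap_zero_C_crankStep_mul (f : ℤ[T;T⁻¹]⟦X⟧) : crankMap 0 (C crankStep * f) = 0 := by
  ext n
  simp only [crankMap, coeff_mapCoeff, coeff_C_mul, crankFunctional_zero_crankStep_mul, map_zero]

/-- The factor `(1 - z q^n) (1 - z⁻¹ q^n)` of the reciprocal of the crank generating function. -/
noncomputable def crankFactor (n : ℕ) : ℤ[T;T⁻¹]⟦X⟧ :=
  (1 - C (T 1) * X ^ n) * (1 - C (T (-1)) * X ^ n)

theorem crankFactor_mul (n : ℕ) (f : ℤ[T;T⁻¹]⟦X⟧) :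
    crankFactor n * f = ((1 + X ^ n) ^ 2 : ℤ⟦X⟧) • f - (X ^ n : ℤ⟦X⟧) • (C crankStep * f) := by
  have hT : C (T 1 : ℤ[T;T⁻¹]) * C (T (-1)) = 1 := by
    rw [← map_mul, ← T_add, add_neg_cancel, T_zero, map_one]
  have hstep : C crankStep = C (T 1) + 2 + C (T (-1)) := by
    simp only [crankStep, map_add, map_ofNat]
  simp only [crankFactor, hstep, Algebra.smul_def, algebraMap_apply'', map_add, map_one, map_pow,
    map_X]
  linear_combination (X ^ n * X ^ n * f) * hT

theorem crankMap_succ_crankFactor_mul (j n : ℕ) (f : ℤ[T;T⁻¹]⟦X⟧) :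
    crankMap (j + 1) (crankFactor n * f) =
      (1 + X ^ n) ^ 2 * crankMap (j + 1) f + X ^ n * crankMap j f := by
  rw [crankFactor_mul, map_sub, map_smul, map_smul, crankMap_succ_C_crankStep_mul, smul_eq_mul,
    smul_eq_mul, mul_neg, sub_neg_eq_add]

theorem crankMap_zero_crankFactor_mul (n : ℕ) (f : ℤ[T;T⁻¹]⟦X⟧) :
    crankMap 0 (crankFactor n * f) = (1 + X ^ n) ^ 2 * crankMap 0 f := by
  rw [crankFactor_mul, map_sub, map_smul, map_smul, crankMap_zero_C_crankStep_mul, smul_zero,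
    sub_zero, smul_eq_mul]

theorem isUnit_one_sub_C_mul_X_pow_succ {R : Type*} [CommRing R] (z : R) (n : ℕ) :
    IsUnit (1 - C z * X ^ (n + 1)) :=
  isUnit_iff_constantCoeff.mpr (by simp)

theorem isUnit_crankFactor_succ (n : ℕ) : IsUnit (crankFactor (n + 1)) :=
  (isUnit_one_sub_C_mul_X_pow_succ _ n).mul (isUnit_one_sub_C_mul_X_pow_succ _ n)

/-- The generating function of pairs of partitions with parts at most `N`, where `z` marks the
difference of the numbers of parts. -/
noncomputable def crankProd (N : ℕ) : ℤ[T;T⁻¹]⟦X⟧ :=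
  ∏ i ∈ Finset.range N, Ring.inverse (crankFactor (i + 1))

theorem crankProd_zero : crankProd 0 = 1 :=
  Finset.prod_range_zero _

theorem crankFactor_mul_crankProd_succ (N : ℕ) :
    crankFactor (N + 1) * crankProd (N + 1) = crankProd N := by
  rw [crankProd, Finset.prod_range_succ_comm,
    Ring.mul_inverse_cancel_left _ _ (isUnit_crankFactor_succ N), crankProd]

theorem weakFactor_succ_mul (n : ℕ) :
    weakFactor (n + 1) * (1 + X ^ (n + 1)) ^ 2 = -X ^ (n + 1) := by
  have hunit : IsUnit (1 + X ^ (n + 1) : ℤ⟦X⟧) := isUnit_iff_constantCoeff.mpr (by simp)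
  rw [weakFactor, Ring.inverse_mul_cancel_right _ _ (hunit.pow 2)]

theorem crankMap_crankProd_mul : ∀ j N : ℕ,
    crankMap j (crankProd N) * ∏ i ∈ Finset.range N, (1 + X ^ (i + 1)) ^ 2 =
      completeHomogeneous weakFactor j N
  | 0, 0 => by simp [crankProd_zero, crankMap_one, crankWeight_zero_left,
      completeHomogeneous_zero_left]
  | j + 1, 0 => by simp [crankProd_zero, crankMap_one, crankWeight_succ_zero,
      completeHomogeneous_succ_zero]
  | 0, N + 1 => by
    have ih := crankMap_crankProd_mul 0 N
    rw [← crankFactor_mul_crankProd_succ, crankMap_zero_crankFactor_mul,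
      completeHomogeneous_zero_left] at ih
    rw [Finset.prod_range_succ, completeHomogeneous_zero_left]
    linear_combination ih
  | j + 1, N + 1 => by
    have ih_pred := crankMap_crankProd_mul (j + 1) N
    rw [← crankFactor_mul_crankProd_succ, crankMap_succ_crankFactor_mul] at ih_pred
    rw [completeHomogeneous_succ_succ, ← ih_pred, ← crankMap_crankProd_mul j (N + 1),
      Finset.prod_range_succ]
    linear_combination (-crankMap j (crankProd (N + 1)) *
      ∏ i ∈ Finset.range N, (1 + X ^ (i + 1)) ^ 2) * weakFactor_succ_mul N

end CrankMap

/-! ### Partitions counted by their number of parts -/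

section PartitionGenFun

variable {R : Type*} [CommSemiring R]

/-- The generating function `∏ 1 / (1 - z q^i)` of the partitions, where `z` marks the number of
parts. -/
noncomputable def partitionGenFun (z : R) : R⟦X⟧ :=
  Nat.Partition.genFun fun _ c => z ^ c

theorem coeff_partitionGenFun (z : R) (n : ℕ) :
    coeff n (partitionGenFun z) = ∑ p : n.Partition, z ^ p.parts.card := by
  rw [partitionGenFun, Nat.Partition.coeff_genFun]
  refine Finset.sum_congr rfl fun p _ => ?_
  rw [Finsupp.prod, Finset.prod_pow_eq_pow_sum, Multiset.toFinsupp_support]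
  simp only [Multiset.toFinsupp_apply, Multiset.toFinset_sum_count_eq]

theorem map_partitionGenFun {S : Type*} [CommSemiring S] (φ : R →+* S) (z : R) :
    map φ (partitionGenFun z) = partitionGenFun (φ z) := by
  ext n
  simp [coeff_partitionGenFun]

theorem hasProd_partitionGenFun {R : Type*} [CommRing R] [TopologicalSpace R] [IsTopologicalRing R]
    [T2Space R] (z : R) :
    HasProd (fun i : ℕ => Ring.inverse (1 - C z * X ^ (i + 1))) (partitionGenFun z) := by
  refine (Nat.Partition.hasProd_genFun fun _ c => z ^ c).congr_fun fun i => ?_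
  have hcoeff : constantCoeff (C z * X ^ (i + 1)) = 0 := by simp
  have hterm (a : ℕ) : (C z * X ^ (i + 1)) ^ (a + 1) = z ^ (a + 1) • X ^ ((i + 1) * (a + 1)) := by
    rw [mul_pow, ← map_pow, ← pow_mul, smul_eq_C_mul]
  rw [← (hasSum_pow hcoeff).tsum_eq, (hasSum_pow hcoeff).summable.tsum_eq_zero_add, pow_zero]
  simp only [hterm]

end PartitionGenFun

section QPochhammer

theorem constantCoeff_qPochInf {a : ℤ⟦X⟧} (ha : constantCoeff a = 0) :
    constantCoeff (qPochInf a) = 1 := by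
  refine ((multipliable_qPochInf a).hasProd.map constantCoeff
    (WithPiTopology.continuous_constantCoeff ℤ)).unique (hasProd_one.congr_fun fun i => ?_)
  simp [ha]

theorem inverse_qPochInf_X : Ring.inverse (qPochInf X) = partitionGenFun 1 := by
  refine inverse_eq_of_mul_eq_one (((multipliable_qPochInf X).hasProd.mul
    (hasProd_partitionGenFun 1)).unique (hasProd_one.congr_fun fun i => ?_))
  have hfactor : (1 - X * X ^ i : ℤ⟦X⟧) = 1 - C 1 * X ^ (i + 1) := by
    rw [map_one, one_mul, pow_succ']
  rw [hfactor, Ring.mul_inverse_cancel _ (isUnit_one_sub_C_mul_X_pow_succ 1 i)]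

theorem prefactor_eq (k : ℕ) :
    prefactor k = partitionGenFun 1 ^ (k - 2) * Ring.inverse (qPochInf (-X) ^ 2) := by
  rw [prefactor, Ring.mul_inverse_rev, ← Ring.inverse_pow (qPochInf X),
    inverse_qPochInf_X, mul_comm]

theorem tendsto_prod_one_add_X_pow_sq :
    Tendsto (fun N => ∏ i ∈ Finset.range N, (1 + X ^ (i + 1) : ℤ⟦X⟧) ^ 2) atTop
      (𝓝 (qPochInf (-X) ^ 2)) := by
  refine ((multipliable_qPochInf (-X)).hasProd.tendsto_prod_nat.pow 2).congr fun N => ?_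
  simp only [← Finset.prod_pow, pow_succ' X, neg_mul, sub_neg_eq_add]

end QPochhammer

section CrankGenFun

open LaurentPolynomial (T)

/-- The generating function `∏ 1 / ((1 - z q^i) (1 - z⁻¹ q^i))` of pairs of partitions, where `z`
marks the difference of the numbers of parts. -/
noncomputable def crankGenFun : ℤ[T;T⁻¹]⟦X⟧ :=
  partitionGenFun (T 1) * partitionGenFun (T (-1))

theorem tendsto_crankMap_crankProd (j : ℕ) :
    Tendsto (fun N => crankMap j (crankProd N)) atTop (𝓝 (crankMap j crankGenFun)) := by
  let _ : TopologicalSpace ℤ[T;T⁻¹] := ⊥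
  have : DiscreteTopology ℤ[T;T⁻¹] := ⟨rfl⟩
  have hprod : HasProd (fun i => Ring.inverse (crankFactor (i + 1))) crankGenFun :=
    ((hasProd_partitionGenFun (T 1)).mul (hasProd_partitionGenFun (T (-1)))).congr_fun fun i => by
      rw [crankFactor, Ring.mul_inverse_rev, mul_comm]
  exact ((continuous_mapCoeff continuous_of_discreteTopology).tendsto _).comp
    hprod.tendsto_prod_nat

theorem crankMap_crankGenFun_mul {j : ℕ} {S : ℤ⟦X⟧}
    (hS : HasSum (fun n : WeakTuple j => weakTerm n.1) S) :
    crankMap j crankGenFun * qPochInf (-X) ^ 2 = S := by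
  simp only [weakTerm_eq_prod] at hS
  refine tendsto_nhds_unique ?_ (tendsto_completeHomogeneous hS)
  exact ((tendsto_crankMap_crankProd j).mul tendsto_prod_one_add_X_pow_sq).congr
    (crankMap_crankProd_mul j)

end CrankGenFun

/-! ### Colored partitions -/

section ColoredPartitions

open LaurentPolynomial (T T_sub T_pow)

theorem coeff_prod_fin {R : Type*} [CommSemiring R] {k : ℕ} (f : Fin k → R⟦X⟧) (n : ℕ) :
    coeff n (∏ i, f i) =
      ∑ c ∈ Finset.Nat.antidiagonalTuple k n, ∏ i, coeff (c i) (f i) := by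
  rw [coeff_prod]
  refine Finset.sum_nbij' (⇑) Finsupp.equivFunOnFinite.symm (fun c hc => ?_) (fun c hc => ?_)
    (fun _ _ => Finsupp.equivFunOnFinite_symm_coe _) (fun _ _ => rfl) fun _ _ => rfl
  · exact Finset.Nat.mem_antidiagonalTuple.mpr (Finset.mem_finsuppAntidiag.mp hc).1
  · exact Finset.mem_finsuppAntidiag.mpr
      ⟨Finset.Nat.mem_antidiagonalTuple.mp hc, Finset.subset_univ _⟩

theorem coeff_prod_partitionGenFun {R : Type*} [CommSemiring R] {k : ℕ} (z : Fin k → R) (n : ℕ) :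
    coeff n (∏ i, partitionGenFun (z i)) =
      ∑ π : ColoredPartition k n, ∏ i, z i ^ (π.2 i).parts.card := by
  rw [coeff_prod_fin, Fintype.sum_sigma, ← Finset.sum_coe_sort]
  simp only [coeff_partitionGenFun, Finset.prod_univ_sum, Fintype.piFinset_univ]

theorem card_parts_le {n : ℕ} (p : n.Partition) : p.parts.card ≤ n := by
  simpa [p.parts_sum] using Multiset.card_nsmul_le_sum (a := 1) fun _ hx => p.parts_pos hx

variable {k : ℕ} (hk : 2 ≤ k)

theorem crank_mem_Icc {n : ℕ} (π : ColoredPartition k n) :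
    crank hk π ∈ Finset.Icc (-(n : ℤ)) n := by
  have hcard (i : Fin k) : (π.2 i).parts.card ≤ n := (card_parts_le _).trans <|
    (Finset.single_le_sum (fun _ _ => Nat.zero_le _) (Finset.mem_univ i)).trans
      (Finset.Nat.mem_antidiagonalTuple.mp π.1.2).le
  have hfst := hcard ⟨0, by omega⟩
  have hsnd := hcard ⟨1, by omega⟩
  rw [Finset.mem_Icc, crank]
  omega

theorem moment_eq_sum (j n : ℕ) :
    moment j hk n = ∑ π : ColoredPartition k n, crankWeight j (crank hk π) := by
  rw [← Finset.sum_fiberwise_of_maps_to fun π _ => crank_mem_Icc hk π, moment]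
  refine Finset.sum_congr rfl fun m _ => ?_
  rw [Finset.sum_congr rfl fun π hπ => congrArg (crankWeight j) (Finset.mem_filter.mp hπ).2,
    Finset.sum_const, crankCount, Fintype.card_subtype, nsmul_eq_mul, mul_comm, crankWeight]

theorem coeff_partitionGenFun_one_pow_mul_crankGenFun (n : ℕ) :
    coeff n (partitionGenFun 1 ^ (k - 2) * crankGenFun) =
      ∑ π : ColoredPartition k n, T (crank hk π) := by
  obtain ⟨k, rfl⟩ := Nat.exists_eq_add_of_le' hk
  let z : Fin (k + 2) → ℤ[T;T⁻¹] := Fin.cons (T 1) (Fin.cons (T (-1)) fun _ => 1)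
  have hprod : partitionGenFun 1 ^ k * crankGenFun = ∏ i, partitionGenFun (z i) := by
    simp only [z, Fin.prod_univ_succ, Fin.cons_zero, Fin.cons_succ, Fin.prod_const, crankGenFun]
    ring
  have hterm (π : ColoredPartition (k + 2) n) :
      ∏ i, z i ^ (π.2 i).parts.card = T (crank hk π) := by
    rw [crank, T_sub]
    simp only [z, Fin.prod_univ_succ, Fin.cons_zero, Fin.cons_succ, one_pow, Finset.prod_const_one,
      mul_one, T_pow, mul_neg]
    rfl
  simp only [Nat.add_sub_cancel, hprod, coeff_prod_partitionGenFun, hterm]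

theorem mk_moment (j : ℕ) :
    PowerSeries.mk (fun n => moment j hk n) =
      partitionGenFun 1 ^ (k - 2) * crankMap j crankGenFun := by
  rw [crankMap, ← mapCoeff_map_mul, map_pow, map_partitionGenFun, map_one]
  ext n
  simp only [coeff_mapCoeff, coeff_mk, coeff_partitionGenFun_one_pow_mul_crankGenFun hk, map_sum,
    crankFunctional_T, moment_eq_sum]

theorem mk_moment_eq_prefactor_mul {j : ℕ} {S : ℤ⟦X⟧}
    (hS : HasSum (fun n : WeakTuple j => weakTerm n.1) S) :
    PowerSeries.mk (fun n => moment j hk n) = prefactor k * S := by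
  have hunit : IsUnit (qPochInf (-X)) :=
    isUnit_iff_constantCoeff.mpr (by simp [constantCoeff_qPochInf])
  rw [mk_moment, prefactor_eq, ← crankMap_crankGenFun_mul hS, mul_comm (crankMap j _), mul_assoc,
    Ring.inverse_mul_cancel_left _ _ (hunit.pow 2)]

end ColoredPartitions

end KCrank

theorem mainTheorem2 (j k : ℕ) (hk : 2 ≤ k) :
    (Summable (fun n : KCrank.WeakTuple j => KCrank.weakTerm n.1) ∧
      PowerSeries.mk (fun n : ℕ => KCrank.moment j hk n) =
        KCrank.prefactor k * ∑' n : KCrank.WeakTuple j, KCrank.weakTerm n.1) ∧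
    (Summable (fun m : KCrank.StrictTuple j => KCrank.strictTerm m.1) ∧
      PowerSeries.mk (fun n : ℕ => KCrank.moment j hk n) =
        KCrank.prefactor k * ∑' m : KCrank.StrictTuple j, KCrank.strictTerm m.1) := by
  obtain ⟨S, hweak, hstrict⟩ := KCrank.exists_hasSum_weakTerm_and_hasSum_strictTerm j
  have h := KCrank.mk_moment_eq_prefactor_mul hk hweak
  exact ⟨⟨hweak.summable, by rw [hweak.tsum_eq, h]⟩,
    ⟨hstrict.summable, by rw [hstrict.tsum_eq, h]⟩⟩
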